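/- Let $E$ be an elliptic curve over $\mathbb Q$, given by $y^2=f(x)$ with $f\in\mathbb Q[x]$ a monic cubic polynomial without repeated roots (for example $f(x)=x^3+ax+b$ with $a,b\in\mathbb Z$ and $4a^3+27b^2\neq 0$). For a squarefree integer $d\neq 0$, of either sign, let $E_d: dy^2=f(x)$ be the quadratic twist of $E$ by $d$, let $r_{\mathrm{al}}(E_d)$ be its algebraic rank, that is, the rank of the abelian group $E_d(\mathbb Q)$, and let $\omega(d)$ be the number of distinct primes dividing $d$. Then there is a constant $C_E$ depending only on $E$ such that for every squarefree integer $d\neq 0$, $$ r_{\mathrm{al}}(E_d)\leq 18\,\omega(d)+C_E. $$ -/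

import Mathlib

namespace WeierstrassCurve

/-- The quadratic twist by `d ≠ 0` of the elliptic curve `E` over `ℚ`. Writing `E` as
`η² = x³ + (b₂/4) x² + (b₄/2) x + b₆/4` with `η = y + (a₁ x + a₃)/2`, it is the curve
`d η² = x³ + (b₂/4) x² + (b₄/2) x + b₆/4`, put into Weierstrass form by `X = d x`, `Y = d² η`.
For `E : y² = x³ + a x + b` it is thus the curve `d y² = x³ + a x + b`, in the form
`Y² = X³ + a d² X + b d³`. -/
def quadraticTwist (E : WeierstrassCurve ℚ) (d : ℤ) : WeierstrassCurve ℚ where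
  a₁ := 0
  a₂ := d * (E.b₂ / 4)
  a₃ := 0
  a₄ := d ^ 2 * (E.b₄ / 2)
  a₆ := d ^ 3 * (E.b₆ / 4)

/-- For `E : y² = x³ + a x + b`, the affine points of the twist are the solutions `(x, y)` of
`d y² = x³ + a x + b`, via the bijection `(x, y) ↦ (d x, d² y)`. -/
theorem equation_quadraticTwist_iff (a b : ℚ) {d : ℤ} (hd : d ≠ 0) (x y : ℚ) :
    (quadraticTwist ⟨0, 0, 0, a, b⟩ d).toAffine.Equation (d * x) (d ^ 2 * y) ↔
      d * y ^ 2 = x ^ 3 + a * x + b := by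
  have h : (d : ℚ) ^ 3 ≠ 0 := pow_ne_zero 3 (Int.cast_ne_zero.mpr hd)
  rw [Affine.equation_iff]
  simp only [quadraticTwist, b₂, b₄, b₆]
  rw [← mul_right_inj' (a := (d : ℚ) ^ 3) h (b := d * y ^ 2)]
  constructor <;> intro H <;> linear_combination H

theorem quadraticTwist_Δ (E : WeierstrassCurve ℚ) (d : ℤ) :
    (E.quadraticTwist d).Δ = d ^ 6 * E.Δ := by
  simp only [quadraticTwist, Δ, b₂, b₄, b₆, b₈]
  ring

/-- The algebraic rank of an elliptic curve `E` over `ℚ`: the rank of the abelian group `E(ℚ)`.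
It is taken as a cardinal, so that a bound by a natural number includes that it is finite. -/
noncomputable def algebraicRank (E : WeierstrassCurve ℚ) : Cardinal :=
  Module.rank ℤ E.toAffine.Point

end WeierstrassCurve

/-! Let `K` be the splitting field of the two-torsion cubic, so `[K : ℚ] ≤ 3! = 6`. Over `K` the
twist is `y² = ∏ (x - d eᵢ)`, and its rank over `ℚ` is at most its rank over `K`, which a 2-descent
bounds.

Outside the two-torsion, send a point to the classes of the three `x - d eᵢ` modulo squares. Points
with equal classes have their sum in `2A`, where `A` is the group of `K`-points
(`exists_add_self_eq_add`). The classes have even valuation outside `S = S₀ ∪ {v ∣ d}`, where `S₀`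
depends only on the `eᵢ` (`Valuation.isSquare_sub_of_sq_eq_prod`). So they lie in a Selmer group of
order at most `2 ^ #S * c`, with `c` depending only on `K` (`finite_selmerGroup`). Hence `2 ^ rank ≤
#(A / 2A) ≤ 4 + (2 ^ #S * c) ³`. As `#S ≤ #S₀ + 6 ω(d)`, the coefficient is `3 * 6 = 18`.

Passing from `A / 2A` to the rank requires `A` to be finitely generated; this comes from descent
with the naive height. -/

namespace WeierstrassCurve

open Height MvPolynomial

/-! ### Naive heights, the approximate parallelogram law and descent. -/

namespace Affine.Point

variable {K : Type*} [Field K] {W : Affine K}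

theorem eval_addSubMap (x : Fin 3 → K) : (fun i ↦ (addSubMap W i).eval x) =
    ![x 0 ^ 2 - W.b₄ * x 0 * x 2 - W.b₆ * x 1 * x 2 - W.b₈ * x 2 ^ 2,
      2 * x 1 * x 0 + W.b₂ * x 0 * x 2 + W.b₄ * x 1 * x 2 + W.b₆ * x 2 ^ 2,
      x 1 ^ 2 - 4 * x 0 * x 2] := by
  ext i
  fin_cases i <;> simp [addSubMap]

theorem exists_smul_sym2x_add_self [DecidableEq K] [W.IsElliptic] (P : W.Point) :
    ∃ c : K, c ≠ 0 ∧ (fun i ↦ (addSubMap W i).eval (P.sym2x P)) = c • (P + P).sym2x 0 := by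
  rcases P with _ | ⟨x, y, h⟩
  · refine ⟨1, one_ne_zero, ?_⟩
    rw [← zero_def, eval_addSubMap, add_zero]
    simp
  have heq := (equation_iff x y).mp h.1
  have hne := addSubMap_ne_zero W (sym2x_ne_zero (some x y h) (some x y h))
  by_cases hy : y = W.negY x y
  · have hz : 4 * x ^ 3 + W.b₂ * x ^ 2 + 2 * W.b₄ * x + W.b₆ = 0 := by
      rw [negY] at hy
      simp only [b₂, b₄, b₆]
      linear_combination -4 * heq + (2 * y + W.a₁ * x + W.a₃) * hy
    -- Here `P + P = 0`: the denominator of the duplication formula vanishes by `hz`, and the scalar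
    -- is its numerator, nonzero because `addSubMap` does not vanish at a nonzero vector.
    refine ⟨x ^ 4 - W.b₄ * x ^ 2 - 2 * W.b₆ * x - W.b₈, ?_, ?_⟩
    · contrapose! hne
      rw [eval_addSubMap]
      ext i
      fin_cases i <;> simp
      · linear_combination hne
      · linear_combination hz
      · ring
    · rw [add_self_of_Y_eq hy, eval_addSubMap]
      ext i
      fin_cases i <;> simp
      · ring
      · linear_combination hz
      · ring
  · have hD : 2 * y + W.a₁ * x + W.a₃ ≠ 0 := by
      contrapose! hy
      rw [negY]
      linear_combination hy
    have hs : W.slope x x y y * (2 * y + W.a₁ * x + W.a₃) =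
        3 * x ^ 2 + 2 * W.a₂ * x + W.a₄ - W.a₁ * y := by
      have h2 : y - W.negY x y = 2 * y + W.a₁ * x + W.a₃ := by rw [negY]; ring
      rw [slope_of_Y_ne rfl hy, h2, div_mul_cancel₀ _ hD]
    refine ⟨(2 * y + W.a₁ * x + W.a₃) ^ 2, pow_ne_zero 2 hD, ?_⟩
    rw [add_self_of_Y_ne hy, eval_addSubMap, sym2x_some_zero, sym2x_some_some]
    generalize W.slope x x y y = ℓ at hs
    ext i
    fin_cases i <;> simp [addX]
    · simp only [b₄, b₆, b₈]
      linear_combination (-(ℓ * (2 * y + W.a₁ * x + W.a₃) + 3 * x ^ 2 + 2 * W.a₂ * x + W.a₄ - W.a₁ * y) - W.a₁ * (2 * y + W.a₁ * x + W.a₃)) * hs +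
        (W.a₁ ^ 2 + 4 * W.a₂ + 8 * x) * heq
    · simp only [b₂, b₄, b₆]
      linear_combination -4 * heq
    · ring

/-- The map `addSubMap` computes `sym2x (P + Q) (P - Q)` from `sym2x P Q`, up to scaling. -/
theorem exists_smul_sym2x_add_sub [DecidableEq K] [W.IsElliptic] (P Q : W.Point) :
    ∃ c : K, c ≠ 0 ∧
      (fun i ↦ (addSubMap W i).eval (P.sym2x Q)) = c • (P + Q).sym2x (P - Q) := by
  rcases P with _ | ⟨x₁, y₁, h₁⟩
  · refine ⟨1, one_ne_zero, ?_⟩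
    rw [← zero_def, zero_add, zero_sub, sym2x_neg_right, eval_addSubMap]
    rcases Q with _ | ⟨x₂, y₂, h₂⟩
    · rw [← zero_def]; simp
    · ext i
      fin_cases i <;> simp <;> ring
  rcases Q with _ | ⟨x₂, y₂, h₂⟩
  · refine ⟨1, one_ne_zero, ?_⟩
    rw [← zero_def, add_zero, sub_zero, eval_addSubMap]
    ext i
    fin_cases i <;> simp <;> ring
  by_cases hx : x₁ = x₂
  · rcases X_eq_iff.mp hx with h | h
    · rw [h, sub_self]
      exact exists_smul_sym2x_add_self _
    · rw [h, sym2x_neg_left, neg_add_cancel, ← neg_add', sym2x_neg_right, sym2x_comm 0]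
      exact exists_smul_sym2x_add_self _
  · have e₁ := (equation_iff x₁ y₁).mp h₁.1
    have e₂ := (equation_iff x₂ y₂).mp h₂.1
    have hd : x₁ - x₂ ≠ 0 := sub_ne_zero.mpr hx
    -- This scalar clears the denominators of the `x`-coordinates of both `P + Q` and `P - Q`.
    refine ⟨(x₁ - x₂) ^ 2, pow_ne_zero 2 hd, ?_⟩
    rw [sub_eq_add_neg (some x₁ y₁ h₁), neg_some, add_of_X_ne hx, add_of_X_ne hx, eval_addSubMap,
      sym2x_some_some, sym2x_some_some]
    have s₁ : W.slope x₁ x₂ y₁ y₂ * (x₁ - x₂) = y₁ - y₂ := by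
      rw [slope_of_X_ne hx, div_mul_cancel₀ _ hd]
    have s₂ : W.slope x₁ x₂ y₁ (W.negY x₂ y₂) * (x₁ - x₂) = y₁ + y₂ + W.a₁ * x₂ + W.a₃ := by
      rw [slope_of_X_ne hx, div_mul_cancel₀ _ hd, negY]; ring
    generalize W.slope x₁ x₂ y₁ y₂ = ℓ at s₁
    generalize W.slope x₁ x₂ y₁ (W.negY x₂ y₂) = m at s₂
    have k₁ : (x₁ - x₂) ^ 2 * W.addX x₁ x₂ ℓ = (y₁ - y₂) ^ 2 + W.a₁ * (y₁ - y₂) * (x₁ - x₂)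
        - (W.a₂ + x₁ + x₂) * (x₁ - x₂) ^ 2 := by
      rw [addX]
      linear_combination (ℓ * (x₁ - x₂) + (y₁ - y₂) + W.a₁ * (x₁ - x₂)) * s₁
    have k₂ : (x₁ - x₂) ^ 2 * W.addX x₁ x₂ m = (y₁ + y₂ + W.a₁ * x₂ + W.a₃) ^ 2
        + W.a₁ * (y₁ + y₂ + W.a₁ * x₂ + W.a₃) * (x₁ - x₂)
        - (W.a₂ + x₁ + x₂) * (x₁ - x₂) ^ 2 := by
      rw [addX]
      linear_combination (m * (x₁ - x₂) + (y₁ + y₂ + W.a₁ * x₂ + W.a₃) + W.a₁ * (x₁ - x₂)) * s₂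
    generalize W.addX x₁ x₂ ℓ = u at k₁
    generalize W.addX x₁ x₂ m = v at k₂
    ext i
    fin_cases i <;> simp
    -- The product `u * v` needs a second factor `(x₁ - x₂) ^ 2` before `k₁` and `k₂` make it
    -- polynomial in the coordinates.
    · apply mul_left_cancel₀ (pow_ne_zero 2 hd)
      rw [show (x₁ - x₂) ^ 2 * ((x₁ - x₂) ^ 2 * (u * v)) =
        ((x₁ - x₂) ^ 2 * u) * ((x₁ - x₂) ^ 2 * v) by ring, k₁, k₂]
      simp only [b₄, b₆, b₈]
      linear_combination
        (x₁^3 - 2 * x₁^2 * x₂ + x₁^2 * W.a₂ - 2 * x₁ * x₂^2 - x₁ * x₂ * W.a₁^2 - 4 * x₁ * x₂ * W.a₂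
          - x₁ * y₁ * W.a₁ - x₁ * W.a₁ * W.a₃ - x₁ * W.a₄ + 2 * x₂^3 + x₂^2 * W.a₁^2 + 2 *
          x₂^2 * W.a₂ + 2 * x₂ * y₂ * W.a₁ + x₂ * W.a₁ * W.a₃ - y₁^2 - y₁ * W.a₃ + 2 *
          y₂^2 + 2 * y₂ * W.a₃ - W.a₆) * e₁ +
        (4 * x₁^3 - 2 * x₁^2 * x₂ + x₁^2 * W.a₁^2 + 4 * x₁^2 * W.a₂ - 2 * x₁ * x₂^2 - x₁ * x₂ *
          W.a₁^2 - 4 * x₁ * x₂ * W.a₂ + x₁ * W.a₁ * W.a₃ + 2 * x₁ * W.a₄ + x₂^3 + x₂^2 *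
          W.a₂ - x₂ * y₂ * W.a₁ - x₂ * W.a₁ * W.a₃ - x₂ * W.a₄ - y₂^2 - y₂ * W.a₃ + W.a₆) * e₂
    · rw [mul_add _ u v, k₁, k₂]
      simp only [b₂, b₄, b₆]
      linear_combination -2 * e₁ - 2 * e₂
    · ring
/-- The naïve logarithmic height of a point: the height of its `x`-coordinate. -/
noncomputable def naiveHeight [AdmissibleAbsValues K] (P : W.Point) : ℝ := logHeight P.xRep

theorem naiveHeight_nonneg [AdmissibleAbsValues K] (P : W.Point) : 0 ≤ P.naiveHeight :=
  logHeight_nonneg _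

theorem logHeight_sym2x [AdmissibleAbsValues K] : ∃ C, ∀ P Q : W.Point,
    |logHeight (P.sym2x Q) - (P.naiveHeight + Q.naiveHeight)| ≤ C := by
  obtain ⟨C, hC⟩ := abs_logHeight_sym2_sub_le K
  have key (x : Fin 2 → K) : ![x 0, x 1] = x := by ext i; fin_cases i <;> rfl
  refine ⟨C, fun P Q ↦ ?_⟩
  have := hC (a := P.xRep 0) (b := P.xRep 1) (c := Q.xRep 0) (d := Q.xRep 1)
    (by rw [key]; exact P.xRep_ne_zero) (by rw [key]; exact Q.xRep_ne_zero)
  rwa [key, key] at this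

/-- `addSubMap` is quadratic and doubles heights up to `C₂`. Comparing `sym2x` with the sum of
heights costs `C₁` at `(P + Q, P - Q)` and `2 * C₁` at `(P, Q)`. -/
theorem abs_naiveHeight_add_sub_le [DecidableEq K] [AdmissibleAbsValues K] [W.IsElliptic] : ∃ C, ∀ P Q : W.Point,
    |(P + Q).naiveHeight + (P - Q).naiveHeight - 2 * (P.naiveHeight + Q.naiveHeight)| ≤ C := by
  obtain ⟨C₁, h₁⟩ := logHeight_sym2x (W := W)
  obtain ⟨C₂, h₂⟩ := abs_logHeight_addSubMap_sub_two_mul_logHeight_le W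
  refine ⟨3 * C₁ + C₂, fun P Q ↦ ?_⟩
  obtain ⟨c, hc, h⟩ := exists_smul_sym2x_add_sub P Q
  have h3 := h₂ (P.sym2x Q)
  rw [h, logHeight_smul_eq_logHeight _ hc] at h3
  have h4 := h₁ P Q
  have h5 := h₁ (P + Q) (P - Q)
  rw [abs_le] at *
  constructor <;> linarith

instance northcott_naiveHeight [AdmissibleAbsValues K] [Northcott (logHeight₁ (K := K))] :
    Northcott (naiveHeight (W := W)) where
  finite_le B := by
    have hfin := Northcott.finite_le (h := logHeight₁ (K := K)) B
    have hfin' : (insert ![1, 0] ((fun x : K ↦ ![x, 1]) '' {x | logHeight₁ x ≤ B})).Finite :=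
      (hfin.image _).insert _
    refine Set.Finite.of_finite_fibers xRep (hfin'.subset ?_) ?_
    · rintro _ ⟨P, hP, rfl⟩
      rcases P with _ | ⟨x, y, h⟩
      · left; rfl
      · right
        refine ⟨x, ?_, rfl⟩
        simpa [naiveHeight, logHeight₁_eq_logHeight] using hP
    · rintro _ ⟨P, -, rfl⟩
      refine (Set.toFinite {P, -P}).subset ?_
      rintro Q ⟨-, hQ⟩
      exact eq_or_eq_neg_of_xRep_eq_xRep hQ

/-- The descent step of Mordell–Weil: finite index of `2A`, the approximate parallelogram law and
the Northcott property give finite generation. -/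
theorem fg_of_finiteIndex [DecidableEq K] [AdmissibleAbsValues K] [Northcott (logHeight₁ (K := K))] [W.IsElliptic]
    (h : (nsmulAddMonoidHom (α := W.Point) 2).range.FiniteIndex) : AddGroup.FG W.Point := by
  obtain ⟨C, hC⟩ := abs_naiveHeight_add_sub_le (W := W)
  exact AddCommGroup.fg_of_descent' h naiveHeight_nonneg hC

end Affine.Point

end WeierstrassCurve

/-! ### Halving points on a curve with full two-torsion. -/

namespace WeierstrassCurve

/-- The curve `y² = (x - e₀) (x - e₁) (x - e₂)`. -/
def ofRoots {K : Type*} [Field K] (e : Fin 3 → K) : WeierstrassCurve K where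
  a₁ := 0
  a₂ := -(e 0 + e 1 + e 2)
  a₃ := 0
  a₄ := e 0 * e 1 + e 0 * e 2 + e 1 * e 2
  a₆ := -(e 0 * e 1 * e 2)

namespace ofRoots

variable {K : Type*} [Field K] {e : Fin 3 → K}

theorem equation_iff {x y : K} : (ofRoots e).toAffine.Equation x y ↔
    y ^ 2 = (x - e 0) * (x - e 1) * (x - e 2) := by
  rw [Affine.equation_iff]
  simp only [ofRoots]
  constructor <;> intro h <;> linear_combination h

theorem equation_iff_prod {x y : K} : (ofRoots e).toAffine.Equation x y ↔
    y ^ 2 = ∏ i, (x - e i) := by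
  rw [equation_iff, Fin.prod_univ_three]

theorem isElliptic (h2 : (2 : K) ≠ 0) (he : Function.Injective e) : (ofRoots e).IsElliptic where
  isUnit := by
    have hΔ : (ofRoots e).Δ = (2 ^ 2 * (e 0 - e 1) * (e 0 - e 2) * (e 1 - e 2)) ^ 2 := by
      simp only [ofRoots, Δ, b₂, b₄, b₆, b₈]
      ring
    have h01 : e 0 - e 1 ≠ 0 := sub_ne_zero.mpr (he.ne (by decide))
    have h02 : e 0 - e 2 ≠ 0 := sub_ne_zero.mpr (he.ne (by decide))
    have h12 : e 1 - e 2 ≠ 0 := sub_ne_zero.mpr (he.ne (by decide))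
    rw [hΔ, isUnit_iff_ne_zero]
    positivity

theorem negY (x y : K) : (ofRoots e).toAffine.negY x y = -y := by
  simp [Affine.negY, ofRoots]

variable [DecidableEq K]

/-- A point all of whose `x - eᵢ` are squares is divisible by two. -/
theorem exists_add_self_eq (h2 : (2 : K) ≠ 0) (he : Function.Injective e) {x y : K}
    (h : (ofRoots e).toAffine.Nonsingular x y) (hsq : ∀ i, IsSquare (x - e i)) :
    ∃ Q : (ofRoots e).toAffine.Point, Q + Q = .some x y h := by
  have := isElliptic h2 he
  obtain ⟨a, b, c, ha, hb, hc, hy⟩ : ∃ a b c, x - e 0 = a ^ 2 ∧ x - e 1 = b ^ 2 ∧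
      x - e 2 = c ^ 2 ∧ y = a * b * c := by
    obtain ⟨a, ha⟩ := hsq 0
    obtain ⟨b, hb⟩ := hsq 1
    obtain ⟨c, hc⟩ := hsq 2
    -- The signs of the square roots can be chosen so that `y = a * b * c`.
    have hy : y ^ 2 = (a * b * c) ^ 2 := by
      rw [equation_iff.mp h.1, ha, hb, hc]
      ring
    rcases sq_eq_sq_iff_eq_or_eq_neg.mp hy with hy | hy
    · exact ⟨a, b, c, by rw [ha, sq], by rw [hb, sq], by rw [hc, sq], hy⟩
    · exact ⟨-a, b, c, by rw [ha]; ring, by rw [hb, sq], by rw [hc, sq], by rw [hy]; ring⟩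
  have hab : a + b ≠ 0 := by
    intro h0
    have : e 0 = e 1 := by linear_combination -ha + hb - (a - b) * h0
    exact absurd (he this) (by decide)
  have hac : a + c ≠ 0 := by
    intro h0
    have : e 0 = e 2 := by linear_combination -ha + hc - (a - c) * h0
    exact absurd (he this) (by decide)
  have hbc : b + c ≠ 0 := by
    intro h0
    have : e 1 = e 2 := by linear_combination -hb + hc - (b - c) * h0
    exact absurd (he this) (by decide)
  -- The classical halving formula: `X - e 0 = (a + b) * (a + c)` and cyclically, and the tangent at
  -- `(X, Y)` has slope `a + b + c`.
  obtain ⟨X, hX⟩ : ∃ X, X = x + a * b + a * c + b * c := ⟨_, rfl⟩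
  obtain ⟨Y, hY⟩ : ∃ Y, Y = (a + b) * (a + c) * (b + c) := ⟨_, rfl⟩
  have hY0 : Y ≠ 0 := hY ▸ mul_ne_zero (mul_ne_zero hab hac) hbc
  have hE : (ofRoots e).toAffine.Equation X Y := by
    rw [equation_iff, show X - e 0 = (a + b) * (a + c) by linear_combination hX + ha,
      show X - e 1 = (a + b) * (b + c) by linear_combination hX + hb,
      show X - e 2 = (a + c) * (b + c) by linear_combination hX + hc, hY]
    ring
  have hne : Y ≠ (ofRoots e).toAffine.negY X Y := by
    rw [negY]
    intro h0
    exact mul_ne_zero h2 hY0 (by linear_combination h0)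
  have hs : (ofRoots e).toAffine.slope X X Y Y = a + b + c := by
    rw [Affine.slope_of_Y_ne rfl hne, negY, div_eq_iff (by
      rw [sub_neg_eq_add, ← two_mul]; exact mul_ne_zero h2 hY0)]
    simp only [ofRoots]
    rw [show e 0 = x - a ^ 2 by linear_combination -ha,
      show e 1 = x - b ^ 2 by linear_combination -hb,
      show e 2 = x - c ^ 2 by linear_combination -hc, hX, hY]
    ring
  refine ⟨.mk hE, ?_⟩
  have hadd : (Affine.Point.mk hE : (ofRoots e).toAffine.Point) + .mk hE = _ :=
    Affine.Point.add_self_of_Y_ne hne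
  have hx' : (ofRoots e).toAffine.addX X X (a + b + c) = x := by
    simp only [Affine.addX, ofRoots]
    linear_combination -2 * hX - ha - hb - hc
  have hy' : (ofRoots e).toAffine.addY X X Y (a + b + c) = y := by
    rw [Affine.addY, negY, Affine.negAddY, hx', hX, hY, hy]
    ring
  rw [hadd, Affine.Point.some.injEq, hs]
  exact ⟨hx', hy'⟩

/-- If all `(x₁ - eᵢ) (x₂ - eᵢ)` are nonzero squares, then the sum of the points is divisible
by two. -/
theorem exists_add_self_eq_add (h2 : (2 : K) ≠ 0) (he : Function.Injective e) {x₁ y₁ x₂ y₂ : K}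
    (h₁ : (ofRoots e).toAffine.Nonsingular x₁ y₁) (h₂ : (ofRoots e).toAffine.Nonsingular x₂ y₂)
    (hx₁ : ∀ i, x₁ - e i ≠ 0) (hx₂ : ∀ i, x₂ - e i ≠ 0)
    (hsq : ∀ i, IsSquare ((x₁ - e i) * (x₂ - e i))) :
    ∃ Q : (ofRoots e).toAffine.Point, Q + Q = .some x₁ y₁ h₁ + .some x₂ y₂ h₂ := by
  by_cases hxy : x₁ = x₂ ∧ y₁ = (ofRoots e).toAffine.negY x₂ y₂
  · exact ⟨0, by rw [Affine.Point.add_of_Y_eq hxy.1 hxy.2, add_zero]⟩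
  rw [Affine.Point.add_some hxy]
  refine exists_add_self_eq h2 he _ fun i ↦ ?_
  -- The line through the two points meets the cubic at abscissas `x₁`, `x₂`, `x₃`. Evaluating at `e
  -- i` shows that the product of the three `xⱼ - e i` is a square.
  have hp := congrArg (Polynomial.eval (e i)) (Affine.addPolynomial_slope h₁.1 h₂.1 hxy)
  generalize (ofRoots e).toAffine.addX x₁ x₂ _ = x₃ at hp ⊢
  generalize (ofRoots e).toAffine.slope x₁ x₂ y₁ y₂ = ℓ at hp
  have hp' : (x₁ - e i) * (x₂ - e i) * (x₃ - e i) = (ℓ * (e i - x₁) + y₁) ^ 2 := by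
    rw [Affine.addPolynomial_eq] at hp
    simp only [ofRoots, Cubic.toPoly, Polynomial.eval_neg, Polynomial.eval_add,
      Polynomial.eval_mul, Polynomial.eval_C, Polynomial.eval_pow, Polynomial.eval_X,
      Polynomial.eval_sub] at hp
    fin_cases i <;> simp at hp ⊢ <;> linear_combination -hp
  obtain ⟨s, hs⟩ := hsq i
  have hs0 : s ≠ 0 := by
    rintro rfl
    exact mul_ne_zero (hx₁ i) (hx₂ i) (by rw [hs, mul_zero])
  refine ⟨(ℓ * (e i - x₁) + y₁) / s, ?_⟩
  rw [div_mul_div_comm, eq_div_iff (mul_ne_zero hs0 hs0), ← hs, ← sq, ← hp']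
  ring

end ofRoots

end WeierstrassCurve

/-! ### Finiteness and size of 2-Selmer groups of a Dedekind domain. -/

namespace IsDedekindDomain

open UniqueFactorizationMonoid

variable {R : Type*} [CommRing R] [IsDedekindDomain R] {K : Type*} [Field K] [Algebra R K]
  [IsFractionRing R K]

namespace HeightOneSpectrum

theorem valuationOfNeZeroMod_two_mk_eq_one_iff (v : HeightOneSpectrum R) (x : Kˣ) :
    v.valuationOfNeZeroMod 2 (QuotientGroup.mk x) = 1 ↔ IsSquare (v.valuation K (x : K)) := by
  have h1 : v.valuationOfNeZeroMod 2 (QuotientGroup.mk x) = 1 ↔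
      (v.valuationOfNeZero x).toAdd ∈ AddSubgroup.zmultiples ((2 : ℕ) : ℤ) := by
    rw [← QuotientAddGroup.eq_zero_iff,
      ← (Int.quotientZMultiplesNatEquivZMod 2).map_eq_zero_iff]
    rfl
  rw [h1, Int.mem_zmultiples_iff, ← valuationOfNeZero_eq]
  constructor
  · rintro ⟨k, hk⟩
    refine ⟨((Multiplicative.ofAdd k : Multiplicative ℤ) : WithZero (Multiplicative ℤ)), ?_⟩
    rw [← WithZero.coe_mul, WithZero.coe_inj, ← ofAdd_add, ← two_mul]
    exact congrArg Multiplicative.ofAdd hk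
  · rintro ⟨m, hm⟩
    have hm0 : m ≠ 0 := by
      rintro rfl
      simp at hm
    obtain ⟨k, rfl⟩ := WithZero.ne_zero_iff_exists.mp hm0
    rw [← WithZero.coe_mul, WithZero.coe_inj] at hm
    exact ⟨k.toAdd, by rw [hm, toAdd_mul, ← two_mul]; rfl⟩

end HeightOneSpectrum

/-- An element of a Dedekind domain all of whose valuations are even generates the square of an
ideal. -/
theorem exists_span_singleton_eq_sq {r : R} (hr : r ≠ 0)
    (h : ∀ v : HeightOneSpectrum R, IsSquare (v.intValuation r)) :
    ∃ J : Ideal R, Ideal.span {r} = J ^ 2 := by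
  classical
  have hI : Ideal.span {r} ≠ 0 := Submodule.span_singleton_eq_bot.mp.mt hr
  obtain ⟨t, ht⟩ := Multiset.exists_smul_of_dvd_count (normalizedFactors (Ideal.span {r}))
    (k := 2) fun p hp ↦ by
      have hpp := prime_of_normalized_factor p hp
      let v : HeightOneSpectrum R := ⟨p, Ideal.isPrime_of_prime hpp, hpp.ne_zero⟩
      obtain ⟨m, hm⟩ := h v
      rw [v.intValuation_eq_exp_neg_multiplicity hr,
        ← HeightOneSpectrum.count_normalizedFactors_eq_multiplicity hI] at hm
      have hm0 : m ≠ 0 := by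
        rintro rfl
        simp at hm
      obtain ⟨k, rfl⟩ : ∃ k : ℤ, m = WithZero.exp k := ⟨_, (WithZero.exp_log hm0).symm⟩
      rw [← WithZero.exp_add, WithZero.exp_inj] at hm
      change 2 ∣ Multiset.count v.asIdeal _
      omega
  refine ⟨t.prod, ?_⟩
  rw [← Multiset.prod_nsmul, ← ht, Ideal.prod_normalizedFactors_eq_self hI]

/-- An element of the fraction field all of whose valuations are even is, up to squares, a
generator of the square of an ideal. -/
theorem exists_mul_sq_eq_of_isSquare_valuation (x : Kˣ)
    (h : ∀ v : HeightOneSpectrum R, IsSquare (v.valuation K (x : K))) :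
    ∃ (r : R) (b : R) (J : Ideal R), r ≠ 0 ∧ b ≠ 0 ∧ Ideal.span {r} = J ^ 2 ∧
      (x : K) * algebraMap R K b ^ 2 = algebraMap R K r := by
  obtain ⟨⟨a, b, hb⟩, hx⟩ := IsLocalization.surj (nonZeroDivisors R) (x : K)
  have hb0 : b ≠ 0 := nonZeroDivisors.ne_zero hb
  have hbK : algebraMap R K b ≠ 0 := by simpa using hb0
  have hx' : (x : K) * algebraMap R K b ^ 2 = algebraMap R K (a * b) := by
    rw [map_mul, ← hx]
    ring
  have hr : a * b ≠ 0 := by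
    intro h0
    rw [h0, map_zero] at hx'
    exact mul_ne_zero x.ne_zero (pow_ne_zero 2 hbK) hx'
  obtain ⟨J, hJ⟩ := exists_span_singleton_eq_sq hr fun v ↦ by
    have hv : v.intValuation (a * b) = v.valuation K (algebraMap R K (a * b)) :=
      (v.valuation_of_algebraMap _).symm
    rw [hv, ← hx', map_mul, map_pow]
    exact (h v).mul (.sq _)
  exact ⟨a * b, b, J, hr, hb0, hJ, hx'⟩

variable (R K) in
-- The image is finitely generated, abelian and killed by 2.
theorem finite_range_fromUnit [Monoid.FG Rˣ] :
    (Set.range (selmerGroup.fromUnit (R := R) (K := K) (n := 2))).Finite := by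
  have hfg : Group.FG (selmerGroup.fromUnit (R := R) (K := K) (n := 2)).range := by
    have : Group.FG Rˣ := Group.fg_iff_monoid_fg.mpr inferInstance
    infer_instance
  have : Finite (selmerGroup.fromUnit (R := R) (K := K) (n := 2)).range := by
    refine CommGroup.finite_of_fg_isMulTorsion _ fun x ↦ ?_
    rw [isOfFinOrder_iff_pow_eq_one]
    refine ⟨2, two_pos, ?_⟩
    obtain ⟨⟨x, hx⟩, u, hu⟩ := x
    ext
    simp only [OneMemClass.coe_one]
    induction x using QuotientGroup.induction_on with
    | H z => exact (QuotientGroup.eq_one_iff _).mpr ⟨z, rfl⟩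
  exact this

variable (R K) in
-- A class is represented by some `r` with `(r) = J²`. The ideal class of `J` takes finitely many
-- values, and two elements with the same class of `J` differ by a unit modulo squares.
theorem finite_selmerGroup_empty [Monoid.FG Rˣ] [Finite (ClassGroup R)] :
    Finite (selmerGroup (R := R) (K := K) (S := ∅) (n := 2)) := by
  have key (h : selmerGroup (R := R) (K := K) (S := ∅) (n := 2)) :
      ∃ (x : Kˣ) (r b : R) (J : nonZeroDivisors (Ideal R)), QuotientGroup.mk x = h.1 ∧ r ≠ 0 ∧
        b ≠ 0 ∧ Ideal.span {r} = (J : Ideal R) ^ 2 ∧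
        (x : K) * algebraMap R K b ^ 2 = algebraMap R K r := by
    obtain ⟨x, hx⟩ := QuotientGroup.mk_surjective h.1
    obtain ⟨r, b, J, hr, hb, hJ, hxr⟩ := exists_mul_sq_eq_of_isSquare_valuation (R := R) x
      fun v ↦ by
        rw [← v.valuationOfNeZeroMod_two_mk_eq_one_iff, hx]
        exact h.2 v (Set.notMem_empty v)
    refine ⟨x, r, b, ⟨J, mem_nonZeroDivisors_of_ne_zero ?_⟩, hx, hr, hb, hJ, hxr⟩
    rintro rfl
    exact hr (by simpa using hJ)
  choose x r b J hx hr hb hJ hxr using key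
  rw [← Set.finite_univ_iff]
  refine Set.Finite.of_finite_fibers (fun h ↦ ClassGroup.mk0 (J h)) (Set.toFinite _) ?_
  rintro _ ⟨h, -, rfl⟩
  refine ((finite_range_fromUnit R K).image (h * ·)).subset ?_
  rintro k ⟨-, hk⟩
  obtain ⟨c, d, hc, hd, hcd⟩ := ClassGroup.mk0_eq_mk0_iff.mp (id hk : _ = _)
  have hspan : Ideal.span {c ^ 2 * r k} = Ideal.span {d ^ 2 * r h} := by
    rw [← Ideal.span_singleton_mul_span_singleton, ← Ideal.span_singleton_mul_span_singleton,
      hJ, hJ, ← Ideal.span_singleton_pow, ← Ideal.span_singleton_pow, ← mul_pow, ← mul_pow, hcd]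
  obtain ⟨u, hu⟩ := Ideal.span_singleton_eq_span_singleton.mp hspan.symm
  refine ⟨selmerGroup.fromUnit u, ⟨u, rfl⟩, ?_⟩
  have hcK : algebraMap R K c ≠ 0 := by simpa using hc
  have hdK : algebraMap R K d ≠ 0 := by simpa using hd
  have hbk : algebraMap R K (b k) ≠ 0 := by simpa using hb k
  have hbh : algebraMap R K (b h) ≠ 0 := by simpa using hb h
  apply Subtype.ext
  change h.1 * QuotientGroup.mk (Units.map (algebraMap R K).toMonoidHom u) = k.1
  rw [← hx h, ← hx k, ← QuotientGroup.mk_mul, QuotientGroup.eq]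
  -- From `d² r_h u = c² r_k` and `r = x b²`, the quotient `x_k / (x_h u)` is the square of `d b_h /
  -- (c b_k)`.
  refine ⟨Units.mk0 ((algebraMap R K d * algebraMap R K (b h)) /
    (algebraMap R K c * algebraMap R K (b k))) (by positivity), ?_⟩
  ext
  have hu' := congrArg (algebraMap R K) hu
  simp only [map_mul, map_pow, ← hxr] at hu'
  have hx0 := (x h).ne_zero
  have hu0 : algebraMap R K u ≠ 0 := ((u.map (algebraMap R K).toMonoidHom)).ne_zero
  simp
  field_simp
  linear_combination hu'

variable (R K) in
-- The valuations modulo 2 at `S` map into `(ℤ/2)^S`, with kernel the Selmer group for `∅`. Only the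
-- power of 2 depends on `S`.
theorem finite_selmerGroup [Monoid.FG Rˣ] [Finite (ClassGroup R)] {S : Set (HeightOneSpectrum R)}
    (hS : S.Finite) : Finite (selmerGroup (R := R) (K := K) (S := S) (n := 2)) ∧
      Nat.card (selmerGroup (R := R) (K := K) (S := S) (n := 2)) ≤
        2 ^ S.ncard * Nat.card (selmerGroup (R := R) (K := K) (S := ∅) (n := 2)) := by
  have := finite_selmerGroup_empty R K
  have := hS.to_subtype
  let f := selmerGroup.valuation (R := R) (K := K) (S := S) (n := 2)
  have hker : Nat.card f.ker =
      Nat.card (selmerGroup (R := R) (K := K) (S := ∅) (n := 2)) := by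
    rw [selmerGroup.valuation_ker_eq]
    exact Nat.card_congr
      (Subgroup.subgroupOfEquivOfLe (selmerGroup.monotone (Set.empty_subset S))).toEquiv
  have hq : Nat.card (_ ⧸ f.ker) ≤ 2 ^ S.ncard := by
    rw [Nat.card_congr (QuotientGroup.quotientKerEquivRange f).toEquiv]
    refine (Nat.card_le_card_of_injective _ Subtype.val_injective).trans ?_
    have := Fintype.ofFinite S
    rw [Nat.card_pi, Finset.prod_const, Finset.card_univ, Fintype.card_eq_nat_card,
      Nat.card_congr Multiplicative.toAdd, Nat.card_zmod]
    rfl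
  have hfk : Finite f.ker := Nat.finite_of_card_ne_zero (by rw [hker]; exact Nat.card_pos.ne')
  have hfq : Finite (_ ⧸ f.ker) :=
    Finite.of_equiv _ (QuotientGroup.quotientKerEquivRange f).toEquiv.symm
  refine ⟨.of_equiv _ (Subgroup.groupEquivQuotientProdSubgroup (s := f.ker)).symm, ?_⟩
  rw [f.ker.card_eq_card_quotient_mul_card_subgroup, hker]
  gcongr

end IsDedekindDomain

/-! ### Rank and the index of the subgroup of doubles. -/

theorem AddCommGroup.two_pow_finrank_le_card_quotient (A : Type*) [AddCommGroup A]
    [AddGroup.FG A] [Finite (A ⧸ (nsmulAddMonoidHom (α := A) 2).range)] :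
    2 ^ Module.finrank ℤ A ≤ Nat.card (A ⧸ (nsmulAddMonoidHom (α := A) 2).range) := by
  have : Module.Finite ℤ A := Module.Finite.iff_addGroup_fg.mpr inferInstance
  rw [← finrank_quotient_eq_of_le_torsion (le_refl (Submodule.torsion ℤ A))]
  let b := Module.finBasis ℤ (A ⧸ Submodule.torsion ℤ A)
  -- Coordinates on the free quotient `A / torsion`, reduced modulo 2: a surjection that kills `2A`.
  let g : A →+ (Fin (Module.finrank ℤ (A ⧸ Submodule.torsion ℤ A)) → ZMod 2) :=
    ((Int.castAddHom (ZMod 2)).compLeft _).comp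
      ((b.equivFun.toLinearMap.comp (Submodule.mkQ _)).toAddMonoidHom)
  have hg : Function.Surjective g := by
    intro z
    choose w hw using fun i ↦ ZMod.intCast_surjective (z i)
    obtain ⟨a, ha⟩ := Submodule.mkQ_surjective _ (b.equivFun.symm w)
    refine ⟨a, ?_⟩
    ext i
    have ha' : b.equivFun (Submodule.mkQ _ a) = w := by rw [ha, LinearEquiv.apply_symm_apply]
    change ((b.equivFun (Submodule.mkQ _ a) i : ℤ) : ZMod 2) = z i
    rw [ha', hw]
  have hker : (nsmulAddMonoidHom (α := A) 2).range ≤ g.ker := by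
    rintro _ ⟨a, rfl⟩
    rw [AddMonoidHom.mem_ker, nsmulAddMonoidHom_apply, map_nsmul]
    ext i
    rw [Pi.smul_apply, nsmul_eq_mul]
    exact mul_eq_zero_of_left (by decide) _
  have := Nat.card_le_card_of_surjective (QuotientAddGroup.lift _ g hker)
    (QuotientAddGroup.lift_surjective_of_surjective _ _ hg _)
  simpa [Nat.card_pi] using this

/-- If any two elements with the same image under `f` have sum divisible by two, then
the index of the subgroup of doubles is at most the size of the target. -/
theorem AddCommGroup.card_quotient_two_le {A T : Type*} [AddCommGroup A] [Finite T] (f : A → T)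
    (hf : ∀ a b, f a = f b → ∃ c, c + c = a + b) :
    Finite (A ⧸ (nsmulAddMonoidHom (α := A) 2).range) ∧
      Nat.card (A ⧸ (nsmulAddMonoidHom (α := A) 2).range) ≤ Nat.card T := by
  have hinj : Function.Injective
      fun q : A ⧸ (nsmulAddMonoidHom (α := A) 2).range ↦ f q.out := by
    intro q q' h
    obtain ⟨c, hc⟩ := hf _ _ h
    rw [← q.out_eq, ← q'.out_eq]
    -- If `2c = a + b`, then `2(c - a) = b - a`.
    refine QuotientAddGroup.eq.mpr ⟨c - q.out, ?_⟩
    rw [nsmulAddMonoidHom_apply, two_nsmul, sub_add_sub_comm, hc]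
    abel
  exact ⟨.of_injective _ hinj, Nat.card_le_card_of_injective _ hinj⟩

/-! ### The 2-descent map and the parity of valuations. -/

namespace WeierstrassCurve.ofRoots

open WeierstrassCurve.Affine

variable {K : Type*} [Field K] [DecidableEq K] {e : Fin 3 → K}

/-- If the classes of `x - eᵢ` modulo squares lie in a finite set for all points outside the
two-torsion, then the subgroup of doubles has finite index. -/
theorem card_quotient_two_le (h2 : (2 : K) ≠ 0) (he : Function.Injective e)
    (H : Set (Kˣ ⧸ (powMonoidHom 2 : Kˣ →* Kˣ).range)) [Finite H]
    (hH : ∀ x y, (ofRoots e).toAffine.Equation x y → ∀ i, ∀ u : Kˣ, (u : K) = x - e i →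
      y ≠ 0 → QuotientGroup.mk u ∈ H) :
    Finite ((ofRoots e).toAffine.Point ⧸ (nsmulAddMonoidHom 2).range) ∧
      Nat.card ((ofRoots e).toAffine.Point ⧸ (nsmulAddMonoidHom 2).range) ≤
        4 + Nat.card H ^ 3 := by
  classical
  have hy {x y : K} (h : (ofRoots e).toAffine.Equation x y) (hy0 : y ≠ 0) (i : Fin 3) :
      x - e i ≠ 0 := by
    have := pow_ne_zero 2 hy0
    rw [equation_iff_prod.mp h] at this
    exact Finset.prod_ne_zero_iff.mp this i (Finset.mem_univ i)
  have hy' {x y : K} (h : (ofRoots e).toAffine.Equation x y) (hy0 : y = 0) : ∃ i, x = e i := by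
    have := equation_iff_prod.mp h
    rw [hy0, zero_pow two_ne_zero, eq_comm, Finset.prod_eq_zero_iff] at this
    obtain ⟨i, -, hi⟩ := this
    exact ⟨i, sub_eq_zero.mp hi⟩
  -- For `y = 0` some `x - e i` is not a unit, so the points of two-torsion get four values of their
  -- own; this is the summand 4.
  let f : (ofRoots e).toAffine.Point → Option (Fin 3) ⊕ (Fin 3 → H)
    | .zero => .inl none
    | .some x y h =>
      if hy0 : y = 0 then .inl (some (hy' h.1 hy0).choose)
      else .inr fun i ↦ ⟨QuotientGroup.mk (Units.mk0 (x - e i) (hy h.1 hy0 i)),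
        hH x y h.1 i _ rfl hy0⟩
  have hcard : Nat.card (Option (Fin 3) ⊕ (Fin 3 → H)) = 4 + Nat.card H ^ 3 := by
    rw [Nat.card_sum, Nat.card_pi]
    simp
  rw [← hcard]
  refine AddCommGroup.card_quotient_two_le f ?_
  rintro (_ | ⟨x₁, y₁, h₁⟩) (_ | ⟨x₂, y₂, h₂⟩) hf
  · exact ⟨0, by rw [← Point.zero_def]⟩
  · by_cases hy0 : y₂ = 0 <;> simp [f, hy0] at hf
  · by_cases hy0 : y₁ = 0 <;> simp [f, hy0] at hf
  · by_cases hy₁ : y₁ = 0 <;> by_cases hy₂ : y₂ = 0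
    · simp only [f, dif_pos hy₁, dif_pos hy₂, Sum.inl.injEq, Option.some.injEq] at hf
      have hx : x₁ = x₂ := by
        rw [(hy' h₁.1 hy₁).choose_spec, hf, ← (hy' h₂.1 hy₂).choose_spec]
      subst hx hy₁ hy₂
      exact ⟨_, rfl⟩
    · simp [f, hy₁, hy₂] at hf
    · simp [f, hy₁, hy₂] at hf
    · simp only [f, dif_neg hy₁, dif_neg hy₂, Sum.inr.injEq] at hf
      refine exists_add_self_eq_add h2 he h₁ h₂ (hy h₁.1 hy₁) (hy h₂.1 hy₂) fun i ↦ ?_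
      obtain ⟨w, hw⟩ := QuotientGroup.eq.mp (congrArg Subtype.val (congrFun hf i))
      have hw' := congrArg Units.val hw
      simp at hw'
      have hne := hy h₁.1 hy₁ i
      refine ⟨(x₁ - e i) * w, ?_⟩
      field_simp at hw'
      linear_combination -(x₁ - e i) * hw'

end WeierstrassCurve.ofRoots

/-- If `y² = ∏ (x - eᵢ)` with `eᵢ` integral and pairwise incongruent at a valuation, then the
valuations of `x - eᵢ` are even. -/
theorem Valuation.isSquare_sub_of_sq_eq_prod {K Γ : Type*} [Field K]
    [LinearOrderedCommGroupWithZero Γ] (v : Valuation K Γ) {e : Fin 3 → K}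
    (he : ∀ i, v (e i) ≤ 1) (hne : ∀ i j, i ≠ j → v (e i - e j) = 1) {x y : K}
    (h : y ^ 2 = ∏ i, (x - e i)) (i : Fin 3) : IsSquare (v (x - e i)) := by
  rcases lt_or_ge 1 (v x) with hx | hx
  · have hj (j : Fin 3) : v (x - e j) = v x :=
      v.map_sub_eq_of_lt_left ((he j).trans_lt hx)
    have hx0 : v x ≠ 0 := (zero_lt_one.trans hx).ne'
    have hv := congrArg v h
    simp only [map_pow, map_prod, hj, Finset.prod_const, Finset.card_univ, Fintype.card_fin] at hv
    refine ⟨v y / v x, ?_⟩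
    -- If `x` has a pole, then `v(y)² = v(x)³`, so `v(x) = (v(y) / v(x))²`.
    rw [hj, div_mul_div_comm, ← sq, hv, eq_div_iff (mul_ne_zero hx0 hx0), pow_succ', sq]
  · have hle : v (x - e i) ≤ 1 := (v.map_sub _ _).trans (max_le hx (he i))
    rcases hle.lt_or_eq with hlt | heq
    -- If `x` is congruent to `e i`, it is incongruent to the other two roots, so `v(y)² = v(x - e
    -- i)`.
    · have hj (j : Fin 3) (hji : j ≠ i) : v (x - e j) = 1 := by
        rw [← sub_add_sub_cancel x (e i) (e j), v.map_add_eq_of_lt_right (by rwa [hne i j hji.symm]),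
          hne i j hji.symm]
      have hv := congrArg v h
      rw [map_pow, map_prod, Finset.prod_eq_single i (fun j _ hji ↦ hj j hji) (by simp)] at hv
      exact ⟨v y, by rw [← hv, sq]⟩
    · exact ⟨1, by rw [heq, one_mul]⟩

/-! ### Counting the places that divide `d` or are bad for the roots. -/

namespace NumberField

open IsDedekindDomain

variable (K : Type*) [Field K] [NumberField K]

theorem ncard_primesOver_le_finrank {p : ℕ} (hp : p.Prime) :
    ((Ideal.span {(p : ℤ)}).primesOver (𝓞 K)).ncard ≤ Module.finrank ℚ K := by
  have hp0 : Ideal.span {(p : ℤ)} ≠ ⊥ := by simpa using hp.ne_zero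
  have hprime : (Ideal.span {(p : ℤ)}).IsPrime :=
    (Ideal.span_singleton_prime (by exact_mod_cast hp.ne_zero)).mpr
      (Nat.prime_iff_prime_int.mp hp)
  have := (Algebra.QuasiFinite.finite_primesOver (S := 𝓞 K) (Ideal.span {(p : ℤ)})).fintype
  -- By the identity `∑ e f = [K : ℚ]`, in which each term is at least 1.
  rw [← RingOfIntegers.rank, ← Ideal.sum_ramification_inertia_eq_finrank (Ideal.span {(p : ℤ)}),
    ← Nat.card_coe_set_eq, Nat.card_eq_fintype_card, ← Finset.card_univ, Finset.card_eq_sum_ones]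
  refine Finset.sum_le_sum fun P _ ↦ ?_
  have := P.2.1
  exact Nat.mul_pos (Ideal.ramificationIdx_pos _ _) (Ideal.inertiaDeg_pos _ _)

/-- At most `[K : ℚ]` times the number of prime divisors of `d` places divide `d`. -/
theorem ncard_valuation_lt_one_le {d : ℤ} (hd : d ≠ 0) :
    {v : HeightOneSpectrum (𝓞 K) | v.valuation K (d : K) < 1}.Finite ∧
    {v : HeightOneSpectrum (𝓞 K) | v.valuation K (d : K) < 1}.ncard ≤
      Module.finrank ℚ K * d.natAbs.primeFactors.card := by
  have hinj : Function.Injective (HeightOneSpectrum.asIdeal (R := 𝓞 K)) :=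
    fun _ _ ↦ HeightOneSpectrum.ext
  have hmem (v : HeightOneSpectrum (𝓞 K)) (n : ℤ) :
      v.valuation K (n : K) < 1 ↔ (n : 𝓞 K) ∈ v.asIdeal := by
    rw [← v.valuation_lt_one_iff_mem (K := K)]
    simp
  let T : Set (Ideal (𝓞 K)) :=
    ⋃ p ∈ d.natAbs.primeFactors, (Ideal.span {(p : ℤ)}).primesOver (𝓞 K)
  have hfin (p : ℕ) : ((Ideal.span {(p : ℤ)}).primesOver (𝓞 K)).Finite :=
    Algebra.QuasiFinite.finite_primesOver _
  have hT : T.Finite := d.natAbs.primeFactors.finite_toSet.biUnion fun p _ ↦ hfin p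
  have hsub : HeightOneSpectrum.asIdeal ''
      {v : HeightOneSpectrum (𝓞 K) | v.valuation K (d : K) < 1} ⊆ T := by
    rintro _ ⟨v, hv, rfl⟩
    have hv' := (hmem v d).mp hv
    have hcomap : d ∈ v.asIdeal.comap (algebraMap ℤ (𝓞 K)) := by simpa using hv'
    have hnat : ((d.natAbs : ℕ) : ℤ) ∈ v.asIdeal.comap (algebraMap ℤ (𝓞 K)) := by
      rcases Int.natAbs_eq d with h | h
      · rwa [← h]
      · rw [h] at hcomap
        simpa using hcomap
    have hd0 : d.natAbs ≠ 0 := Int.natAbs_ne_zero.mpr hd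
    have hprime : (v.asIdeal.comap (algebraMap ℤ (𝓞 K))).IsPrime := inferInstance
    rw [← Nat.prod_factorization_pow_eq_self hd0, Finsupp.prod, Nat.cast_prod,
      hprime.prod_mem_iff] at hnat
    obtain ⟨p, hp, hpm⟩ := hnat
    rw [Nat.cast_pow] at hpm
    have hpm' := hprime.mem_of_pow_mem _ hpm
    rw [Nat.support_factorization] at hp
    have hpp := Nat.prime_of_mem_primeFactors hp
    simp only [T, Set.mem_iUnion]
    refine ⟨p, hp, v.isPrime, ⟨?_⟩⟩
    have hmax : (Ideal.span {(p : ℤ)}).IsMaximal :=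
      PrincipalIdealRing.isMaximal_of_irreducible (Nat.prime_iff_prime_int.mp hpp).irreducible
    exact hmax.eq_of_le hprime.ne_top ((Ideal.span_singleton_le_iff_mem _).mpr hpm')
  refine ⟨Set.Finite.of_finite_image (hT.subset hsub) hinj.injOn, ?_⟩
  rw [← Set.ncard_image_of_injective _ hinj]
  refine (Set.ncard_le_ncard hsub hT).trans ?_
  refine (Finset.set_ncard_biUnion_le _ _).trans ?_
  rw [mul_comm, ← smul_eq_mul]
  exact Finset.sum_le_card_nsmul _ _ _ fun p hp ↦
    ncard_primesOver_le_finrank K (Nat.prime_of_mem_primeFactors hp)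

variable {K} in
/-- All but finitely many places are good for the family `e`. -/
theorem finite_setOf_not_integral_or_congruent {e : Fin 3 → K} (he : Function.Injective e) :
    {v : HeightOneSpectrum (𝓞 K) | ¬ ((∀ i, v.valuation K (e i) ≤ 1) ∧
      ∀ i j, i ≠ j → v.valuation K (e i - e j) = 1)}.Finite := by
  refine ((Set.finite_iUnion fun i ↦ HeightOneSpectrum.Support.finite (𝓞 K) (e i)).union
    (Set.finite_iUnion fun i ↦ Set.finite_iUnion fun j ↦
      (HeightOneSpectrum.Support.finite (𝓞 K) (e i - e j)).union
        (HeightOneSpectrum.Support.finite (𝓞 K) (e i - e j)⁻¹))).subset ?_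
  intro v hv
  by_contra hn
  simp only [Set.mem_union, Set.mem_iUnion, not_or, not_exists, HeightOneSpectrum.Support,
    Set.mem_ofPred_eq, not_lt, map_inv₀] at hn
  refine hv ⟨hn.1, fun i j hij ↦ le_antisymm (hn.2 i j).1 ?_⟩
  have h0 : v.valuation K (e i - e j) ≠ 0 :=
    (Valuation.ne_zero_iff _).mpr (sub_ne_zero.mpr (he.ne hij))
  exact (inv_le_one₀ (zero_lt_iff.mpr h0)).mp (hn.2 i j).2

end NumberField

/-! ### The rank bound over a number field. -/

namespace WeierstrassCurve.ofRoots

open IsDedekindDomain NumberField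

/-- The Mordell–Weil theorem for `y² = (x - e₀) (x - e₁) (x - e₂)` over a number field, with a
bound for the rank in terms of the number of places of bad reduction. -/
theorem rank_point_le {K : Type*} [Field K] [NumberField K] [DecidableEq K] {e : Fin 3 → K}
    (he : Function.Injective e) {S : Set (HeightOneSpectrum (𝓞 K))} (hS : S.Finite)
    (hgood : ∀ v ∉ S, (∀ i, v.valuation K (e i) ≤ 1) ∧
      ∀ i j, i ≠ j → v.valuation K (e i - e j) = 1) :
    Module.rank ℤ (ofRoots e).toAffine.Point ≤ ((3 * S.ncard + (4 +
      Nat.card (selmerGroup (R := 𝓞 K) (K := K) (S := ∅) (n := 2)) ^ 3) : ℕ) : Cardinal) := by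
  have := isElliptic two_ne_zero he
  obtain ⟨hfin, hcard⟩ := finite_selmerGroup (𝓞 K) K hS
  obtain ⟨hfin', hcard'⟩ := card_quotient_two_le two_ne_zero he
    (selmerGroup (R := 𝓞 K) (K := K) (S := S) (n := 2) : Set (Kˣ ⧸ (powMonoidHom 2).range))
    fun x y hxy i u hu hy v hv ↦ by
      rw [v.valuationOfNeZeroMod_two_mk_eq_one_iff, hu]
      exact (v.valuation K).isSquare_sub_of_sq_eq_prod (hgood v hv).1 (hgood v hv).2
        (equation_iff_prod.mp hxy) i
  have hfg : AddGroup.FG (ofRoots e).toAffine.Point := by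
    refine Affine.Point.fg_of_finiteIndex ?_
    exact AddSubgroup.finiteIndex_of_finite_quotient
  have : Module.Finite ℤ (ofRoots e).toAffine.Point :=
    Module.Finite.iff_addGroup_fg.mpr inferInstance
  rw [← Module.finrank_eq_rank, Nat.cast_le]
  have h2 := (AddCommGroup.two_pow_finrank_le_card_quotient _).trans hcard'
  set c := Nat.card (selmerGroup (R := 𝓞 K) (K := K) (S := ∅) (n := 2))
  refine (Nat.pow_le_pow_iff_right one_lt_two).mp (h2.trans ?_)
  -- The crude bound `n ≤ 2 ^ n` moves `4 + c ^ 3` into the exponent; it enters only the additive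
  -- constant.
  calc 4 + _ ^ 3 ≤ 4 + (2 ^ S.ncard * c) ^ 3 := by gcongr; exact hcard
    _ ≤ 2 ^ (3 * S.ncard) * (4 + c ^ 3) := by
      have : 1 ≤ 2 ^ (3 * S.ncard) := Nat.one_le_two_pow
      rw [mul_pow, ← pow_mul, mul_comm S.ncard 3]
      nlinarith
    _ ≤ 2 ^ (3 * S.ncard) * 2 ^ (4 + c ^ 3) := by
      gcongr
      exact Nat.lt_two_pow_self.le
    _ = _ := (pow_add _ _ _).symm

end WeierstrassCurve.ofRoots

/-! ### The splitting field of the two-torsion cubic and the bound for twists. -/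

namespace Polynomial

/-- The splitting field of a separable polynomial of degree `n` has degree at most `n!`. -/
theorem finrank_splittingField_le_factorial {F : Type*} [Field F] {p : F[X]} (hp : p.Separable) :
    Module.finrank F p.SplittingField ≤ p.natDegree.factorial := by
  have : Fact ((p.map (algebraMap F p.SplittingField)).Splits) := ⟨SplittingField.splits p⟩
  rw [← Gal.card_of_separable hp,
    ← card_rootSet_eq_natDegree (K := p.SplittingField) hp (SplittingField.splits p),
    ← Fintype.card_eq_nat_card]
  classical
  rw [← Fintype.card_perm]
  -- The Galois group acts faithfully on the roots.
  exact Fintype.card_le_of_injective _ (Gal.galActionHom_injective p p.SplittingField)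

end Polynomial

namespace WeierstrassCurve

/-- The cubic polynomial `x³ + (b₂/4) x² + (b₄/2) x + b₆/4` whose roots are the `x`-coordinates of
the two-torsion points. -/
def monicTwoTorsionCubic (E : WeierstrassCurve ℚ) : Cubic ℚ := ⟨1, E.b₂ / 4, E.b₄ / 2, E.b₆ / 4⟩

theorem discr_monicTwoTorsionCubic_ne_zero (E : WeierstrassCurve ℚ) [E.IsElliptic] :
    E.monicTwoTorsionCubic.discr ≠ 0 := by
  have h : E.Δ = 16 * E.monicTwoTorsionCubic.discr := by
    simp only [monicTwoTorsionCubic, Cubic.discr, Δ, b₂, b₄, b₆, b₈]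
    ring
  have hΔ : E.Δ ≠ 0 := E.isUnit_Δ.ne_zero
  rw [h] at hΔ
  exact right_ne_zero_of_mul hΔ

/-- Over a field that contains the roots of the two-torsion polynomial, the quadratic twists have
the form `y² = (x - d e₀) (x - d e₁) (x - d e₂)`. -/
theorem baseChange_quadraticTwist_eq_ofRoots (E : WeierstrassCurve ℚ) {K : Type*} [Field K]
    [Algebra ℚ K] {x y z : K}
    (h : (E.monicTwoTorsionCubic.map (algebraMap ℚ K)).roots = {x, y, z}) (d : ℤ) :
    (E.quadraticTwist d)⁄K = ofRoots fun i ↦ (d : K) * ![x, y, z] i := by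
  have ha : E.monicTwoTorsionCubic.a ≠ 0 := one_ne_zero
  have h1 : algebraMap ℚ K E.monicTwoTorsionCubic.a = 1 := map_one _
  have hb : algebraMap ℚ K (E.b₂ / 4) = _ := Cubic.b_eq_three_roots ha h
  have hc : algebraMap ℚ K (E.b₄ / 2) = _ := Cubic.c_eq_three_roots ha h
  have hd : algebraMap ℚ K (E.b₆ / 4) = _ := Cubic.d_eq_three_roots ha h
  rw [h1] at hb hc hd
  ext
  · exact map_zero _
  · change algebraMap ℚ K (d * (E.b₂ / 4)) = -(d * x + d * y + d * z)
    rw [map_mul, hb, map_intCast]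
    ring
  · exact map_zero _
  · change algebraMap ℚ K (d ^ 2 * (E.b₄ / 2)) = d * x * (d * y) + d * x * (d * z) + d * y * (d * z)
    rw [map_mul, map_pow, hc, map_intCast]
    ring
  · change algebraMap ℚ K (d ^ 3 * (E.b₆ / 4)) = -(d * x * (d * y) * (d * z))
    rw [map_mul, map_pow, hd, map_intCast]
    ring

theorem exists_roots_baseChange_quadraticTwist (E : WeierstrassCurve ℚ) [E.IsElliptic] :
    ∃ e : Fin 3 → E.monicTwoTorsionCubic.toPoly.SplittingField, Function.Injective e ∧
      ∀ d : ℤ, (E.quadraticTwist d)⁄(E.monicTwoTorsionCubic.toPoly.SplittingField) =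
        ofRoots fun i ↦ (d : E.monicTwoTorsionCubic.toPoly.SplittingField) * e i := by
  have ha : E.monicTwoTorsionCubic.a ≠ 0 := one_ne_zero
  obtain ⟨x, y, z, h⟩ := (Cubic.splits_iff_roots_eq_three ha).mp
    (Polynomial.SplittingField.splits E.monicTwoTorsionCubic.toPoly)
  obtain ⟨hxy, hxz, hyz⟩ :=
    (Cubic.discr_ne_zero_iff_roots_ne ha h).mp E.discr_monicTwoTorsionCubic_ne_zero
  refine ⟨![x, y, z], ?_, E.baseChange_quadraticTwist_eq_ofRoots h⟩
  intro i j hij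
  fin_cases i <;> fin_cases j <;> simp_all

theorem finrank_splittingField_monicTwoTorsionCubic_le (E : WeierstrassCurve ℚ) [E.IsElliptic] :
    Module.finrank ℚ E.monicTwoTorsionCubic.toPoly.SplittingField ≤ 6 := by
  have ha : E.monicTwoTorsionCubic.a ≠ 0 := one_ne_zero
  have hsplit := Polynomial.SplittingField.splits E.monicTwoTorsionCubic.toPoly
  have hsep : E.monicTwoTorsionCubic.toPoly.Separable := by
    rw [← Polynomial.nodup_aroots_iff_of_splits (Cubic.ne_zero_of_a_ne_zero ha) hsplit,
      Polynomial.aroots, ← Cubic.map_toPoly]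
    exact (Cubic.discr_ne_zero_iff_roots_nodup ha hsplit).mp E.discr_monicTwoTorsionCubic_ne_zero
  have := Polynomial.finrank_splittingField_le_factorial hsep
  rwa [Cubic.natDegree_of_a_ne_zero ha] at this

/-- The rank does not decrease under extension of the base field. -/
theorem algebraicRank_le_rank_baseChange (W : WeierstrassCurve ℚ) (K : Type) [Field K]
    [DecidableEq K] [Algebra ℚ K] :
    W.algebraicRank ≤ Module.rank ℤ (W⁄K).toAffine.Point := by
  have hW : W⁄ℚ = W := W.map_id
  have h : (W⁄ℚ).algebraicRank ≤ Module.rank ℤ (W⁄K).toAffine.Point :=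
    LinearMap.rank_le_of_injective
      (Affine.Point.map (W' := W.toAffine) (Algebra.ofId ℚ K)).toIntLinearMap
      (Affine.Point.map_injective _)
  rwa [hW] at h

open IsDedekindDomain NumberField in
/-- If `E` has full two-torsion over a number field `K`, the rank of its quadratic twist by `d`
is at most `3 [K : ℚ]` times the number of prime divisors of `d`, up to a constant. -/
theorem exists_algebraicRank_quadraticTwist_le (E : WeierstrassCurve ℚ) {K : Type} [Field K]
    [NumberField K] {e : Fin 3 → K} (he : Function.Injective e)
    (hcurve : ∀ d : ℤ, (E.quadraticTwist d)⁄K = ofRoots fun i ↦ (d : K) * e i) :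
    ∃ C : ℕ, ∀ d : ℤ, d ≠ 0 → (E.quadraticTwist d).algebraicRank ≤
      ((3 * (Module.finrank ℚ K * d.natAbs.primeFactors.card) + C : ℕ) : Cardinal) := by
  classical
  have hS₀ := finite_setOf_not_integral_or_congruent he
  set S₀ := {v : HeightOneSpectrum (𝓞 K) | ¬ ((∀ i, v.valuation K (e i) ≤ 1) ∧
      ∀ i j, i ≠ j → v.valuation K (e i - e j) = 1)}
  refine ⟨3 * S₀.ncard + (4 +
    Nat.card (selmerGroup (R := 𝓞 K) (K := K) (S := ∅) (n := 2)) ^ 3), fun d hd ↦ ?_⟩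
  obtain ⟨hfin, hcard⟩ := ncard_valuation_lt_one_le K hd
  set S₁ := {v : HeightOneSpectrum (𝓞 K) | v.valuation K (d : K) < 1}
  have hdK : (d : K) ≠ 0 := Int.cast_ne_zero.mpr hd
  -- Where `d` is a unit, multiplying the roots by `d` changes neither their integrality nor their
  -- incongruence, so `S₀` serves all twists.
  have hgood (v) (hv : v ∉ S₀ ∪ S₁) : (∀ i, v.valuation K (d * e i) ≤ 1) ∧
      ∀ i j, i ≠ j → v.valuation K (d * e i - d * e j) = 1 := by
    rw [Set.mem_union, not_or] at hv
    obtain ⟨hv₀, hv₁⟩ := hv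
    rw [Set.mem_ofPred_eq, not_not] at hv₀
    have hle : v.valuation K (d : K) ≤ 1 := by
      simpa using v.valuation_le_one (K := K) (d : 𝓞 K)
    have h1 : v.valuation K (d : K) = 1 := hle.antisymm (not_lt.mp hv₁)
    simpa only [← mul_sub, map_mul, h1, one_mul] using hv₀
  have hrank := ofRoots.rank_point_le (e := fun i ↦ (d : K) * e i)
    (fun i j hij ↦ he (mul_left_cancel₀ hdK hij)) (hS₀.union hfin) hgood
  rw [← hcurve d] at hrank
  refine (algebraicRank_le_rank_baseChange _ K).trans (hrank.trans (Nat.cast_le.mpr ?_))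
  have hu := Set.ncard_union_le S₀ S₁
  omega

end WeierstrassCurve

theorem lemma6p1 (E : WeierstrassCurve ℚ) [E.IsElliptic] :
    ∃ C : ℕ, ∀ d : ℤ, Squarefree d →
      (E.quadraticTwist d).algebraicRank ≤
        ((18 * ArithmeticFunction.cardDistinctFactors d.natAbs + C : ℕ) : Cardinal) := by
  obtain ⟨e, he, hcurve⟩ := E.exists_roots_baseChange_quadraticTwist
  have : NumberField E.monicTwoTorsionCubic.toPoly.SplittingField :=
    { to_charZero := charZero_of_injective_algebraMap (algebraMap ℚ _).injective }
  obtain ⟨C, hC⟩ := E.exists_algebraicRank_quadraticTwist_le he hcurve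
  refine ⟨C, fun d hd ↦ (hC d hd.ne_zero).trans (Nat.cast_le.mpr ?_)⟩
  have hω : ArithmeticFunction.cardDistinctFactors d.natAbs = d.natAbs.primeFactors.card := rfl
  have := Nat.mul_le_mul_right d.natAbs.primeFactors.card
    E.finrank_splittingField_monicTwoTorsionCubic_le
  omega
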